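/- Let $\mathcal H$ be a separable real Hilbert space and let $\mathrm P,\mathrm Q$ be Borel probability measures on $\mathcal H$; no moments are assumed. A Lipschitz hypersurface is a set of the form $\{z+\tau(z)v : z\in Z\}$, where $v\in\mathcal H\setminus\{0\}$, $Z=\{\lambda v:\lambda\in\mathbb R\}^\perp$ and $\tau:\mathcal H\to\mathbb R$ is Lipschitz. For a proper convex function $\psi:\mathcal H\to(-\infty,+\infty]$ let $\partial\psi(x)=\{y\in\mathcal H:\ \psi(x)+\langle y,x'-x\rangle\le\psi(x')\ \text{for all } x'\in\mathcal H\}$, and write $\nabla\psi(x)$ for the unique element of $\partial\psi(x)$ whenever $\partial\psi(x)$ is a singleton. We say that $\nabla\psi$ pushes $\mathrm P$ forward to $\mathrm Q$ if $\partial\psi(x)$ is a singleton for $\mathrm P$-almost every $x$, the $\mathrm P$-a.e. defined map $\nabla\psi$ is $\mathrm P$-measurable, and $\nabla\psi\#\mathrm P=\mathrm Q$. Suppose that $\mathrm P$ gives mass zero to every Lipschitz hypersurface. Then: (i) there exists a proper lower semicontinuous convex function $\psi:\mathcal H\to(-\infty,+\infty]$ such that $\nabla\psi$ pushes $\mathrm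 P$ forward to $\mathrm Q$; (ii) if in addition $\operatorname{supp}(\mathrm Q)$ is bounded, then $\nabla\psi$ is unique $\mathrm P$-a.s.: if $\psi_1,\psi_2:\mathcal H\to(-\infty,+\infty]$ are proper convex functions (lower semicontinuous or not) whose gradients both push $\mathrm P$ forward to $\mathrm Q$, then $\nabla\psi_1=\nabla\psi_2$ $\mathrm P$-a.s. -/

import Mathlib

open MeasureTheory

namespace HilbertTransport

variable {H : Type*} [NormedAddCommGroup H] [InnerProductSpace ℝ H]

/-- A proper convex function `ψ : H → (-∞, +∞]`: it never takes the value `-∞`, is not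
identically `+∞`, and satisfies the convexity inequality in the extended reals. -/
structure IsProperConvex (ψ : H → EReal) : Prop where
  ne_bot : ∀ x, ψ x ≠ ⊥
  exists_ne_top : ∃ x, ψ x ≠ ⊤
  convex : ∀ x y : H, ∀ a b : ℝ, 0 < a → 0 < b → a + b = 1 →
    ψ (a • x + b • y) ≤ (a : EReal) * ψ x + (b : EReal) * ψ y

/-- The subdifferential of `ψ` at `x`: all `y` with `ψ x + ⟪y, x' - x⟫ ≤ ψ x'` for every `x'`. -/
def subdifferential (ψ : H → EReal) (x : H) : Set H :=
  {y | ∀ x' : H, ψ x + ((inner ℝ y (x' - x) : ℝ) : EReal) ≤ ψ x'}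

/-- The points at which the subdifferential of `ψ` is a singleton. -/
def gradDomain (ψ : H → EReal) : Set H :=
  {x | ∃ y, subdifferential ψ x = {y}}

open Classical in
/-- The gradient of `ψ`: the unique element of the subdifferential on `gradDomain ψ`
(and, by convention, `0` elsewhere). -/
noncomputable def grad (ψ : H → EReal) (x : H) : H :=
  if h : ∃ y, subdifferential ψ x = {y} then h.choose else 0

/-- Lipschitz hypersurfaces: sets `{z + τ(z) v : z ∈ Z}`, where `v ≠ 0`, `Z` is the orthogonal
complement of the line spanned by `v`, and `τ : H → ℝ` is Lipschitz. -/
def IsLipschitzHypersurface (A : Set H) : Prop :=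
  ∃ v : H, v ≠ 0 ∧ ∃ τ : H → ℝ, (∃ K : NNReal, LipschitzWith K τ) ∧
    A = {x | ∃ z ∈ (Submodule.span ℝ {v})ᗮ, x = z + τ z • v}

/-- `P` gives mass zero to every Lipschitz hypersurface. -/
def NullOnLipschitzHypersurfaces [MeasurableSpace H] (P : Measure H) : Prop :=
  ∀ A : Set H, IsLipschitzHypersurface A → P A = 0

/-- The gradient of `ψ` is defined `P`-almost everywhere, is a `P`-measurable map, and pushes
`P` forward to `Q`. -/
structure GradPushesForward [MeasurableSpace H] (ψ : H → EReal) (P Q : Measure H) : Prop where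
  ae_mem_gradDomain : ∀ᵐ x ∂P, x ∈ gradDomain ψ
  aemeasurable : AEMeasurable (grad ψ) P
  map_eq : P.map (grad ψ) = Q

end HilbertTransport

/-!
Existence. For a bounded cost, an optimal plan `γ` cannot be improved by rearranging the second
components of points of its support. Truncations of the cost `-⟪y, x⟫` have optimal plans by weak
compactness of the set of couplings, and a cluster point of these plans still has a cyclically
monotone support, although no moments are assumed. Rockafellar's construction puts that support
into the graph of a subdifferential. This graph is monotone, and the points where a monotone map
takes two values separated by a gap in a direction `v` lie on a Lipschitz hypersurface over `vᗮ`;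
countably many gaps suffice, so the subdifferential is almost surely single-valued.

Uniqueness. Let `ψ₁`, `ψ₂` be two potentials with conjugates `φ₁`, `φ₂` and let `g = φ₂ - φ₁`.
Fenchel–Young, with equality exactly on the graph of the subdifferential, bounds `ψ₁ - ψ₂` between
`g ∘ ∇ψ₂` and `g ∘ ∇ψ₁`. Both have the law of `g` under `Q`, so all inequalities are equalities.
-/

namespace HilbertTransport

open Filter ProbabilityTheory Topology

section Subdifferential

variable {H : Type*} [NormedAddCommGroup H] [InnerProductSpace ℝ H] {ψ : H → EReal} {x y : H}

lemma subdifferential_eq_singleton_grad (hx : x ∈ gradDomain ψ) :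
    subdifferential ψ x = {grad ψ x} := by
  have hx' : ∃ y, subdifferential ψ x = {y} := hx
  rw [grad, dif_pos hx']
  exact hx'.choose_spec

lemma grad_mem_subdifferential (hx : x ∈ gradDomain ψ) : grad ψ x ∈ subdifferential ψ x :=
  (subdifferential_eq_singleton_grad hx).ge rfl

lemma eq_grad_of_mem_subdifferential (hx : x ∈ gradDomain ψ) (hy : y ∈ subdifferential ψ x) :
    y = grad ψ x :=
  (subdifferential_eq_singleton_grad hx).le hy

lemma mem_gradDomain_of_subsingleton (hs : (subdifferential ψ x).Subsingleton)
    (hy : y ∈ subdifferential ψ x) : x ∈ gradDomain ψ :=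
  ⟨y, hs.eq_singleton_of_mem hy⟩

lemma ne_top_of_mem_subdifferential (hψ : ∃ z, ψ z ≠ ⊤) (hy : y ∈ subdifferential ψ x) :
    ψ x ≠ ⊤ := by
  rintro htop
  obtain ⟨z, hz⟩ := hψ
  have h := hy z
  rw [htop, EReal.top_add_coe, top_le_iff] at h
  exact hz h

lemma subdifferential_eq_univ_of_eq_bot (hx : ψ x = ⊥) : subdifferential ψ x = Set.univ := by
  simp [subdifferential, hx]

lemma subdifferential_eq_univ_of_eq_top (hx : ψ x = ⊤) (hy : y ∈ subdifferential ψ x) :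
    subdifferential ψ x = Set.univ := by
  have hψ : ∀ z, ψ z = ⊤ := by
    by_contra! hne
    exact ne_top_of_mem_subdifferential hne hy hx
  simp [subdifferential, hψ]

lemma coe_toReal_of_mem_gradDomain [Nontrivial H] (hx : x ∈ gradDomain ψ) :
    ((ψ x).toReal : EReal) = ψ x := by
  have hne : subdifferential ψ x ≠ Set.univ := by
    rw [subdifferential_eq_singleton_grad hx]
    exact Set.singleton_ne_univ _
  exact EReal.coe_toReal
    (fun htop => hne (subdifferential_eq_univ_of_eq_top htop (grad_mem_subdifferential hx)))
    (fun hbot => hne (subdifferential_eq_univ_of_eq_bot hbot))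

end Subdifferential

section Conjugate

variable {H : Type*} [NormedAddCommGroup H] [InnerProductSpace ℝ H] {ψ : H → EReal} {x y : H}

/-- The convex conjugate `y ↦ sup_x (⟪y, x⟫ - ψ x)` of an extended-real-valued function `ψ`, used
for the Fenchel–Young inequality and its equality case. -/
noncomputable def conjugate (ψ : H → EReal) (y : H) : EReal :=
  ⨆ x, ((inner ℝ y x : ℝ) : EReal) - ψ x

lemma lowerSemicontinuous_conjugate (ψ : H → EReal) : LowerSemicontinuous (conjugate ψ) := by
  refine lowerSemicontinuous_iSup fun x => ?_
  induction ψ x with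
  | bot => simpa using lowerSemicontinuous_const
  | top => simpa using lowerSemicontinuous_const
  | coe r =>
    have : Continuous fun y : H => ((inner ℝ y x - r : ℝ) : EReal) :=
      continuous_coe_real_ereal.comp (by fun_prop)
    simpa using this.lowerSemicontinuous

lemma inner_le_toReal_add_toReal_conjugate (hx : ((ψ x).toReal : EReal) = ψ x)
    (hy : ((conjugate ψ y).toReal : EReal) = conjugate ψ y) :
    inner ℝ y x ≤ (ψ x).toReal + (conjugate ψ y).toReal := by
  have h : ((inner ℝ y x : ℝ) : EReal) - ψ x ≤ conjugate ψ y :=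
    le_iSup (fun x => ((inner ℝ y x : ℝ) : EReal) - ψ x) x
  rw [← hx, ← hy, ← EReal.coe_sub, EReal.coe_le_coe_iff] at h
  linarith

lemma mem_subdifferential_iff_conjugate_le {r : ℝ} (hr : ψ x = r) :
    y ∈ subdifferential ψ x ↔ conjugate ψ y ≤ ((inner ℝ y x - r : ℝ) : EReal) := by
  rw [conjugate, iSup_le_iff]
  refine forall_congr' fun z => ?_
  rw [hr, inner_sub_right]
  induction ψ z with
  | bot => simp [← EReal.coe_add, -EReal.coe_sub]
  | top => simp
  | coe s =>
    norm_cast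
    constructor <;> intro h <;> linarith

lemma conjugate_eq_of_mem_subdifferential {r : ℝ} (hr : ψ x = r) (hy : y ∈ subdifferential ψ x) :
    conjugate ψ y = ((inner ℝ y x - r : ℝ) : EReal) := by
  refine le_antisymm ((mem_subdifferential_iff_conjugate_le hr).1 hy) ?_
  rw [EReal.coe_sub, ← hr]
  exact le_iSup (fun x => ((inner ℝ y x : ℝ) : EReal) - ψ x) x

lemma mem_subdifferential_iff_toReal_add_toReal_conjugate_eq
    (hx : ((ψ x).toReal : EReal) = ψ x) (hy : ((conjugate ψ y).toReal : EReal) = conjugate ψ y) :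
    y ∈ subdifferential ψ x ↔ (ψ x).toReal + (conjugate ψ y).toReal = inner ℝ y x := by
  rw [mem_subdifferential_iff_conjugate_le hx.symm, ← hy, EReal.coe_le_coe_iff, hy,
    le_sub_iff_add_le', (inner_le_toReal_add_toReal_conjugate hx hy).ge_iff_eq']

end Conjugate

section Uniqueness

lemma ae_eq_of_ae_le_of_map_eq {Ω : Type*} [MeasurableSpace Ω] {μ : Measure Ω} [IsFiniteMeasure μ]
    {f g : Ω → ℝ} (hf : AEMeasurable f μ) (hg : AEMeasurable g μ) (hle : f ≤ᵐ[μ] g)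
    (hmap : μ.map f = μ.map g) : f =ᵐ[μ] g := by
  -- A bounded strictly increasing function makes the two variables integrable.
  have hint : ∀ h : Ω → ℝ, AEMeasurable h μ → Integrable (fun ω => Real.arctan (h ω)) μ := by
    intro h hh
    refine Integrable.of_bound
      (Real.continuous_arctan.measurable.comp_aemeasurable hh).aestronglyMeasurable
      (Real.pi / 2) (.of_forall fun ω => ?_)
    exact abs_le.2 ⟨(Real.neg_pi_div_two_lt_arctan _).le, (Real.arctan_lt_pi_div_two _).le⟩
  have hintegral : ∫ ω, Real.arctan (f ω) ∂μ = ∫ ω, Real.arctan (g ω) ∂μ := by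
    rw [← integral_map hf Real.continuous_arctan.aestronglyMeasurable, hmap,
      integral_map hg Real.continuous_arctan.aestronglyMeasurable]
  have hle' : (fun ω => Real.arctan (f ω)) ≤ᵐ[μ] fun ω => Real.arctan (g ω) :=
    hle.mono fun ω hω => Real.arctan_strictMono.monotone hω
  filter_upwards [(integral_eq_iff_of_ae_le (hint f hf) (hint g hg) hle').1 hintegral] with ω hω
  exact Real.arctan_strictMono.injective hω

lemma ae_eq_comp_of_ae_le_of_map_eq {Ω Y : Type*} [MeasurableSpace Ω] [MeasurableSpace Y]
    {μ : Measure Ω} [IsFiniteMeasure μ] {S T : Ω → Y} {d : Ω → ℝ} {g : Y → ℝ}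
    (hS : AEMeasurable S μ) (hT : AEMeasurable T μ) (hmap : μ.map S = μ.map T) (hg : Measurable g)
    (hSd : ∀ᵐ ω ∂μ, g (S ω) ≤ d ω) (hdT : ∀ᵐ ω ∂μ, d ω ≤ g (T ω)) :
    ∀ᵐ ω ∂μ, d ω = g (T ω) := by
  have hmap' : μ.map (g ∘ S) = μ.map (g ∘ T) := by
    rw [← AEMeasurable.map_map_of_aemeasurable hg.aemeasurable hS, hmap,
      AEMeasurable.map_map_of_aemeasurable hg.aemeasurable hT]
  have hle : g ∘ S ≤ᵐ[μ] g ∘ T := by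
    filter_upwards [hSd, hdT] with ω h₁ h₂ using h₁.trans h₂
  filter_upwards [hSd, hdT, ae_eq_of_ae_le_of_map_eq (hg.comp_aemeasurable hS)
    (hg.comp_aemeasurable hT) hle hmap'] with ω h₁ h₂ h
  exact le_antisymm h₂ (h.ge.trans h₁)

variable {H : Type*} [NormedAddCommGroup H] [InnerProductSpace ℝ H] [MeasurableSpace H]
  [OpensMeasurableSpace H] {P Q : Measure H} {ψ ψ₁ ψ₂ : H → EReal}

lemma GradPushesForward.ae_coe_toReal_conjugate [Nontrivial H] (h : GradPushesForward ψ P Q) :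
    ∀ᵐ y ∂Q, ((conjugate ψ y).toReal : EReal) = conjugate ψ y := by
  have hmeas := (lowerSemicontinuous_conjugate ψ).measurable
  rw [← h.map_eq]
  refine (ae_map_iff h.aemeasurable (measurableSet_eq_fun
    (measurable_coe_real_ereal.comp hmeas.ereal_toReal) hmeas)).2 ?_
  filter_upwards [h.ae_mem_gradDomain] with x hx
  rw [Function.comp_apply, conjugate_eq_of_mem_subdifferential
    (coe_toReal_of_mem_gradDomain hx).symm (grad_mem_subdifferential hx), EReal.toReal_coe]

lemma GradPushesForward.ae_inner_grad_le_and_eq_iff [Nontrivial H]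
    (h₁ : GradPushesForward ψ₁ P Q) (h₂ : GradPushesForward ψ₂ P Q) :
    ∀ᵐ x ∂P, inner ℝ (grad ψ₂ x) x ≤ (ψ₁ x).toReal + (conjugate ψ₁ (grad ψ₂ x)).toReal ∧
      ((ψ₁ x).toReal + (conjugate ψ₁ (grad ψ₂ x)).toReal = inner ℝ (grad ψ₂ x) x ↔
        grad ψ₂ x = grad ψ₁ x) := by
  have hfin : ∀ᵐ x ∂P,
      ((conjugate ψ₁ (grad ψ₂ x)).toReal : EReal) = conjugate ψ₁ (grad ψ₂ x) :=
    ae_of_ae_map h₂.aemeasurable (h₂.map_eq.symm ▸ h₁.ae_coe_toReal_conjugate)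
  filter_upwards [h₁.ae_mem_gradDomain, hfin] with x hx hy
  have hψ := coe_toReal_of_mem_gradDomain hx
  refine ⟨inner_le_toReal_add_toReal_conjugate hψ hy, ?_⟩
  rw [← mem_subdifferential_iff_toReal_add_toReal_conjugate_eq hψ hy,
    subdifferential_eq_singleton_grad hx, Set.mem_singleton_iff]

theorem GradPushesForward.ae_eq [IsFiniteMeasure P] (h₁ : GradPushesForward ψ₁ P Q)
    (h₂ : GradPushesForward ψ₂ P Q) : ∀ᵐ x ∂P, grad ψ₁ x = grad ψ₂ x := by
  cases subsingleton_or_nontrivial H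
  · exact .of_forall fun x => Subsingleton.elim _ _
  set g : H → ℝ := fun y => (conjugate ψ₂ y).toReal - (conjugate ψ₁ y).toReal
  have hgm : Measurable g := (lowerSemicontinuous_conjugate ψ₂).measurable.ereal_toReal.sub
    (lowerSemicontinuous_conjugate ψ₁).measurable.ereal_toReal
  -- Both bounds on `ψ₁ - ψ₂` have the law of `g` under `Q`, so the upper one is attained.
  have hd : ∀ᵐ x ∂P, (ψ₁ x).toReal - (ψ₂ x).toReal = g (grad ψ₁ x) := by
    refine ae_eq_comp_of_ae_le_of_map_eq h₂.aemeasurable h₁.aemeasurable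
      (h₂.map_eq.trans h₁.map_eq.symm) hgm ?_ ?_
    · filter_upwards [h₁.ae_inner_grad_le_and_eq_iff h₂, h₂.ae_inner_grad_le_and_eq_iff h₂]
        with x h₁₂ h₂₂
      linarith [h₁₂.1, h₂₂.2.2 rfl]
    · filter_upwards [h₁.ae_inner_grad_le_and_eq_iff h₁, h₂.ae_inner_grad_le_and_eq_iff h₁]
        with x h₁₁ h₂₁
      linarith [h₂₁.1, h₁₁.2.2 rfl]
  filter_upwards [hd, h₁.ae_inner_grad_le_and_eq_iff h₁, h₂.ae_inner_grad_le_and_eq_iff h₁]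
    with x hx h₁₁ h₂₁
  exact h₂₁.2.1 (by linarith [h₁₁.2.2 rfl])

end Uniqueness

section CyclicMonotonicity

/-- A set of pairs is cyclically monotone for the cost `c` if no permutation of the second
components of finitely many of its elements relative to the first ones lowers the total cost. -/
def IsCyclicallyMonotone {X Y : Type*} (c : X × Y → ℝ) (S : Set (X × Y)) : Prop :=
  ∀ (n : ℕ) (q : Fin n → X × Y) (σ : Equiv.Perm (Fin n)), (∀ i, q i ∈ S) →
    ∑ i, c (q i) ≤ ∑ i, c ((q (σ i)).1, (q i).2)

variable {H : Type*} [NormedAddCommGroup H] [InnerProductSpace ℝ H] {S : Set (H × H)}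
  {p₀ : H × H} {n : ℕ}

/-- The value at `x` of the last affine minorant built along the chain `q 0, …, q n`, namely
`∑ i < n, ⟪yᵢ, xᵢ₊₁ - xᵢ⟫ + ⟪yₙ, x - xₙ⟫` where `q i = (xᵢ, yᵢ)`. -/
noncomputable def chainSum (q : Fin (n + 1) → H × H) (x : H) : ℝ :=
  ∑ i : Fin n, inner ℝ (q i.castSucc).2 ((q i.succ).1 - (q i.castSucc).1) +
    inner ℝ (q (Fin.last n)).2 (x - (q (Fin.last n)).1)

lemma chainSum_snoc (q : Fin (n + 1) → H × H) (p : H × H) (x : H) :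
    chainSum (Fin.snoc q p : Fin (n + 2) → H × H) x = chainSum q p.1 + inner ℝ p.2 (x - p.1) := by
  simp only [chainSum, Fin.sum_univ_castSucc, Fin.succ_last, ← Fin.castSucc_succ, Fin.snoc_castSucc,
    Fin.snoc_last]

lemma continuous_chainSum (q : Fin (n + 1) → H × H) : Continuous (chainSum q) := by
  unfold chainSum
  fun_prop

lemma chainSum_add (q : Fin (n + 1) → H × H) (x y : H) {a b : ℝ} (hab : a + b = 1) :
    chainSum q (a • x + b • y) = a * chainSum q x + b * chainSum q y := by
  simp only [chainSum, inner_sub_right, inner_add_right, inner_smul_right]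
  linear_combination (inner ℝ (q (Fin.last n)).2 (q (Fin.last n)).1 -
    ∑ i : Fin n, (inner ℝ (q i.castSucc).2 (q i.succ).1 -
      inner ℝ (q i.castSucc).2 (q i.castSucc).1)) * hab

lemma IsCyclicallyMonotone.chainSum_nonpos
    (hS : IsCyclicallyMonotone (fun p : H × H => -inner ℝ p.2 p.1) S) {q : Fin (n + 1) → H × H}
    (hq : ∀ i, q i ∈ S) : chainSum q (q 0).1 ≤ 0 := by
  have h := hS (n + 1) q (finRotate (n + 1)) hq
  simp only [Fin.sum_univ_castSucc, finRotate_apply, Fin.coeSucc_eq_succ, Fin.last_add_one,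
    Finset.sum_neg_distrib] at h
  simp only [chainSum, inner_sub_right, Finset.sum_sub_distrib]
  linarith

/-- Rockafellar's potential of a set `S` of pairs: the supremum of the affine functions `chainSum q`
over the finite chains `q` in `S` starting at `p₀`. -/
noncomputable def rockafellar (S : Set (H × H)) (p₀ : H × H) (x : H) : EReal :=
  ⨆ (n : ℕ) (q : Fin (n + 1) → H × H) (_ : q 0 = p₀ ∧ ∀ i, q i ∈ S), (chainSum q x : EReal)

lemma chainSum_le_rockafellar {q : Fin (n + 1) → H × H} (hq : ∀ i, q i ∈ S) (x : H) :
    (chainSum q x : EReal) ≤ rockafellar S (q 0) x :=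
  le_iSup_of_le n (le_iSup_of_le q (le_iSup_of_le ⟨rfl, hq⟩ le_rfl))

lemma rockafellar_le {x : H} {b : EReal}
    (h : ∀ (n : ℕ) (q : Fin (n + 1) → H × H), q 0 = p₀ → (∀ i, q i ∈ S) → chainSum q x ≤ b) :
    rockafellar S p₀ x ≤ b :=
  iSup_le fun n => iSup_le fun q => iSup_le fun hq => h n q hq.1 hq.2

lemma lowerSemicontinuous_rockafellar (S : Set (H × H)) (p₀ : H × H) :
    LowerSemicontinuous (rockafellar S p₀) :=
  lowerSemicontinuous_iSup fun _ => lowerSemicontinuous_iSup fun q => lowerSemicontinuous_iSup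
    fun _ => (continuous_coe_real_ereal.comp (continuous_chainSum q)).lowerSemicontinuous

lemma IsCyclicallyMonotone.isProperConvex_rockafellar
    (hS : IsCyclicallyMonotone (fun p : H × H => -inner ℝ p.2 p.1) S) (h₀ : p₀ ∈ S) :
    IsProperConvex (rockafellar S p₀) where
  ne_bot x := ne_bot_of_le_ne_bot (EReal.coe_ne_bot _)
    (chainSum_le_rockafellar (q := fun _ : Fin 1 => p₀) (fun _ => h₀) x)
  exists_ne_top := by
    refine ⟨p₀.1, ne_top_of_le_ne_top EReal.zero_ne_top (rockafellar_le ?_)⟩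
    rintro n q rfl hq
    exact_mod_cast hS.chainSum_nonpos hq
  convex x y a b ha hb hab := by
    refine rockafellar_le ?_
    rintro n q rfl hq
    rw [chainSum_add q x y hab, EReal.coe_add, EReal.coe_mul, EReal.coe_mul]
    gcongr
    · exact chainSum_le_rockafellar hq x
    · exact chainSum_le_rockafellar hq y

lemma mem_subdifferential_rockafellar (p₀ : H × H) {p : H × H} (hp : p ∈ S) :
    p.2 ∈ subdifferential (rockafellar S p₀) p.1 := by
  intro x
  rw [← EReal.le_sub_iff_add_le (.inl (EReal.coe_ne_bot _)) (.inl (EReal.coe_ne_top _))]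
  refine rockafellar_le ?_
  rintro n q rfl hq
  rw [EReal.le_sub_iff_add_le (.inl (EReal.coe_ne_bot _)) (.inl (EReal.coe_ne_top _)),
    ← EReal.coe_add, ← chainSum_snoc]
  have hqp : ∀ i, (Fin.snoc q p : Fin (n + 2) → H × H) i ∈ S :=
    Fin.lastCases (by simpa using hp) fun i => by simpa using hq i
  simpa [Fin.snoc_zero] using chainSum_le_rockafellar hqp x

end CyclicMonotonicity

section Monotone

variable {H : Type*} [NormedAddCommGroup H] [InnerProductSpace ℝ H] {T : H → Set H} {v : H}

/-- A set-valued map `T` on a Hilbert space is monotone if `⟪y - y', x - x'⟫ ≥ 0` whenever `y ∈ T x`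
and `y' ∈ T x'`. -/
def IsMonotoneOperator (T : H → Set H) : Prop :=
  ∀ ⦃x x' y y' : H⦄, y ∈ T x → y' ∈ T x' → 0 ≤ inner ℝ (y - y') (x - x')

lemma isMonotoneOperator_subdifferential {ψ : H → EReal} (hbot : ∀ x, ψ x ≠ ⊥)
    (htop : ∃ x, ψ x ≠ ⊤) : IsMonotoneOperator (subdifferential ψ) := by
  intro x x' y y' hy hy'
  have h := hy x'
  have h' := hy' x
  lift ψ x to ℝ using ⟨ne_top_of_mem_subdifferential htop hy, hbot x⟩ with r
  lift ψ x' to ℝ using ⟨ne_top_of_mem_subdifferential htop hy', hbot x'⟩ with r'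
  norm_cast at h h'
  rw [← neg_sub x x', inner_neg_right] at h
  rw [inner_sub_left]
  linarith

lemma exists_isLipschitzHypersurface_superset (hv : v ≠ 0) {A : Set H} {K : ℝ}
    (hA : ∀ x ∈ A, ∀ x' ∈ A, ∀ (t : ℝ) (w : H), x - x' = t • v + w → inner ℝ v w = 0 →
      |t| ≤ K * ‖w‖) : ∃ B, IsLipschitzHypersurface B ∧ A ⊆ B := by
  have hvv : inner ℝ v v ≠ 0 := inner_self_ne_zero.2 hv
  set t : H → ℝ := fun x => inner ℝ v x / inner ℝ v v
  set π : H → H := fun x => x - t x • v with hπ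
  have horth : ∀ x, inner ℝ v (π x) = 0 := fun x => by
    rw [inner_sub_right, inner_smul_right, div_mul_cancel₀ _ hvv, sub_self]
  have hlip : ∀ x ∈ A, ∀ x' ∈ A, |t x - t x'| ≤ K * ‖π x - π x'‖ := fun x hx x' hx' =>
    hA x hx x' hx' _ _ (by simp only [hπ, sub_smul]; abel)
      (by rw [inner_sub_right, horth, horth, sub_zero])
  have hinj : Set.InjOn π A := by
    intro x hx x' hx' h
    have htt : t x = t x' := by simpa [h, sub_eq_zero] using hlip x hx x' hx'
    simpa [hπ, htt] using h
  have hinv := hinj.leftInvOn_invFunOn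
  have hf : LipschitzOnWith K.toNNReal (fun z => t (Function.invFunOn π A z)) (π '' A) := by
    refine LipschitzOnWith.of_dist_le' ?_
    rintro _ ⟨x, hx, rfl⟩ _ ⟨x', hx', rfl⟩
    simpa only [hinv hx, hinv hx', dist_eq_norm, Real.norm_eq_abs] using hlip x hx x' hx'
  obtain ⟨τ, hτ, hτf⟩ := hf.extend_real
  refine ⟨_, ⟨v, hv, τ, ⟨_, hτ⟩, rfl⟩, fun x hx => ⟨π x, ?_, ?_⟩⟩
  · exact Submodule.mem_orthogonal_singleton_iff_inner_right.2 (horth x)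
  · have hτx : τ (π x) = t x := by simpa only [hinv hx] using (hτf ⟨x, hx, rfl⟩).symm
    rw [hτx, sub_add_cancel]

/-- The points at which `T` takes two values of norm at most `R` whose inner products with `v` are
separated by the interval `[a, b]`. Countably many of these sets cover the points where `T` is
multivalued. -/
def gapSet (T : H → Set H) (v : H) (a b R : ℝ) : Set H :=
  {x | ∃ y₁ ∈ T x, ∃ y₂ ∈ T x, ‖y₁‖ ≤ R ∧ ‖y₂‖ ≤ R ∧ inner ℝ y₁ v < a ∧ b < inner ℝ y₂ v}

lemma IsMonotoneOperator.abs_le_of_mem_gapSet (hT : IsMonotoneOperator T) {a b R : ℝ} (hab : a < b)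
    {x x' : H} (hx : x ∈ gapSet T v a b R) (hx' : x' ∈ gapSet T v a b R) {t : ℝ} {w : H}
    (h : x - x' = t • v + w) : |t| ≤ 2 * R / (b - a) * ‖w‖ := by
  wlog ht : 0 ≤ t generalizing x x' t w
  · rw [← abs_neg, ← norm_neg w]
    refine this hx' hx ?_ (by linarith)
    rw [← neg_sub, h, neg_smul, neg_add]
  obtain ⟨y, hy, -, -, hyR, -, hya, -⟩ := hx
  obtain ⟨-, -, y', hy', -, hyR', -, hyb'⟩ := hx'
  have hmono : 0 ≤ t * (inner ℝ y v - inner ℝ y' v) + inner ℝ (y - y') w := by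
    simpa only [h, inner_add_right, inner_smul_right, inner_sub_left y y' v] using hT hy hy'
  have hw : inner ℝ (y - y') w ≤ 2 * R * ‖w‖ :=
    (real_inner_le_norm _ _).trans (mul_le_mul_of_nonneg_right
      ((norm_sub_le _ _).trans (by linarith)) (norm_nonneg _))
  have hgap : t * (b - a) ≤ t * (inner ℝ y' v - inner ℝ y v) :=
    mul_le_mul_of_nonneg_left (by linarith) ht
  rw [abs_of_nonneg ht, div_mul_eq_mul_div, le_div_iff₀ (sub_pos.2 hab)]
  linarith

lemma exists_mem_gapSet {x : H} (hx : ¬(T x).Subsingleton) {u : ℕ → H} (hu : DenseRange u) :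
    ∃ (k : ℕ) (a b : ℚ) (n : ℕ), a < b ∧ x ∈ gapSet T (u k) a b n := by
  obtain ⟨y₁, hy₁, y₂, hy₂, hne⟩ := Set.not_subsingleton_iff.1 hx
  have hopen : IsOpen {v : H | inner ℝ y₁ v < inner ℝ y₂ v} :=
    isOpen_lt (by fun_prop) (by fun_prop)
  have hsep : inner ℝ y₁ (y₂ - y₁) < inner ℝ y₂ (y₂ - y₁) := by
    rw [← sub_pos, ← inner_sub_left]
    exact real_inner_self_pos.2 (sub_ne_zero.2 hne.symm)
  obtain ⟨k, hk⟩ := hu.exists_mem_open hopen ⟨_, hsep⟩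
  obtain ⟨b, hab, hb⟩ := exists_rat_btwn (show inner ℝ y₁ (u k) < inner ℝ y₂ (u k) from hk)
  obtain ⟨a, ha, hab⟩ := exists_rat_btwn hab
  obtain ⟨n, hn⟩ := exists_nat_ge (max ‖y₁‖ ‖y₂‖)
  exact ⟨k, a, b, n, by exact_mod_cast hab, y₁, hy₁, y₂, hy₂, (le_max_left _ _).trans hn,
    (le_max_right _ _).trans hn, ha, hb⟩

variable [MeasurableSpace H] {P : Measure H}

lemma NullOnLipschitzHypersurfaces.measure_gapSet (hP : NullOnLipschitzHypersurfaces P)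
    (hT : IsMonotoneOperator T) (v : H) {a b : ℝ} (hab : a < b) (R : ℝ) :
    P (gapSet T v a b R) = 0 := by
  rcases eq_or_ne v 0 with rfl | hv
  · have hempty : gapSet T 0 a b R = ∅ := by
      refine Set.eq_empty_of_forall_notMem ?_
      rintro x ⟨y₁, -, y₂, -, -, -, ha, hb⟩
      rw [inner_zero_right] at ha hb
      linarith
    rw [hempty, measure_empty]
  · obtain ⟨B, hB, hsub⟩ := exists_isLipschitzHypersurface_superset hv
      fun x hx x' hx' t w h _ => hT.abs_le_of_mem_gapSet hab hx hx' h
    exact measure_mono_null hsub (hP B hB)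

lemma NullOnLipschitzHypersurfaces.ae_subsingleton [TopologicalSpace.SeparableSpace H]
    (hP : NullOnLipschitzHypersurfaces P) (hT : IsMonotoneOperator T) :
    ∀ᵐ x ∂P, (T x).Subsingleton := by
  have hall : ∀ᵐ x ∂P, ∀ (k : ℕ) (a b : ℚ) (n : ℕ), a < b →
      x ∉ gapSet T (TopologicalSpace.denseSeq H k) a b n := by
    simp only [ae_all_iff]
    intro k a b n hab
    exact measure_eq_zero_iff_ae_notMem.1 (hP.measure_gapSet hT _ (by exact_mod_cast hab) n)
  filter_upwards [hall] with x hx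
  by_contra hne
  obtain ⟨k, a, b, n, hab, hmem⟩ := exists_mem_gapSet hne (TopologicalSpace.denseRange_denseSeq H)
  exact hx k a b n hab hmem

end Monotone

section OptimalPlans

variable {X Y : Type*} [MeasurableSpace X] [MeasurableSpace Y] {c : X × Y → ℝ}
  {γ ν : Measure (X × Y)} {ι : Type*} [Fintype ι]

/-- A measure on `X × Y` is an optimal plan for the cost `c` if no measure with the same marginals
has smaller total cost. Since non-integrable functions have integral `0`, this is meaningful only
for costs that are integrable for all these measures, such as bounded ones. -/
def IsOptimalPlan (c : X × Y → ℝ) (γ : Measure (X × Y)) : Prop :=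
  ∀ γ' : Measure (X × Y), γ'.fst = γ.fst → γ'.snd = γ.snd → ∫ p, c p ∂γ ≤ ∫ p, c p ∂γ'

lemma IsOptimalPlan.smul (h : IsOptimalPlan c γ) {t : ENNReal} (ht₀ : t ≠ 0) (ht : t ≠ ⊤) :
    IsOptimalPlan c (t • γ) := by
  intro γ' hfst hsnd
  have hle : ∫ p, c p ∂γ ≤ ∫ p, c p ∂(t⁻¹ • γ') := by
    refine h _ ?_ ?_
    · rw [Measure.fst, Measure.map_smul, ← Measure.fst, hfst, Measure.fst, Measure.map_smul,
        smul_smul, ENNReal.inv_mul_cancel ht₀ ht, one_smul, Measure.fst]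
    · rw [Measure.snd, Measure.map_smul, ← Measure.snd, hsnd, Measure.snd, Measure.map_smul,
        smul_smul, ENNReal.inv_mul_cancel ht₀ ht, one_smul, Measure.snd]
  have hpos : 0 < t.toReal := ENNReal.toReal_pos ht₀ ht
  rwa [integral_smul_measure, ENNReal.toReal_inv, smul_eq_mul, le_inv_mul_iff₀ hpos,
    ← smul_eq_mul, ← integral_smul_measure] at hle

lemma IsOptimalPlan.of_le [IsFiniteMeasure γ] (h : IsOptimalPlan c γ) (hc : Measurable c) {C : ℝ}
    (hC : ∀ p, ‖c p‖ ≤ C) (hν : ν ≤ γ) : IsOptimalPlan c ν := by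
  intro γ' hfst hsnd
  have : IsFiniteMeasure ν := isFiniteMeasure_of_le γ hν
  have : IsFiniteMeasure (γ - ν) := isFiniteMeasure_of_le γ Measure.sub_le
  have : IsFiniteMeasure γ' := ⟨by
    rw [← Measure.fst_univ, hfst, Measure.fst_univ]
    exact measure_lt_top ν _⟩
  have hint : ∀ (μ : Measure (X × Y)) [IsFiniteMeasure μ], Integrable c μ := fun μ _ =>
    .of_bound hc.aestronglyMeasurable C (.of_forall hC)
  have hsub : γ - ν + ν = γ := Measure.sub_add_cancel_of_le hν
  have hle : ∫ p, c p ∂(γ - ν + ν) ≤ ∫ p, c p ∂(γ - ν + γ') := by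
    rw [hsub]
    refine h _ ?_ ?_
    · rw [Measure.fst_add, hfst, ← Measure.fst_add, hsub]
    · rw [Measure.snd_add, hsnd, ← Measure.snd_add, hsub]
  rw [integral_add_measure (hint _) (hint _), integral_add_measure (hint _) (hint _)] at hle
  exact le_of_add_le_add_left hle

lemma exists_sum_cond_le_smul {Ω : Type*} [MeasurableSpace Ω] {μ : Measure Ω} {W : ι → Set Ω}
    (hW : ∀ i, μ (W i) ≠ 0) : ∃ t : ENNReal, t ≠ 0 ∧ t ≠ ⊤ ∧ ∑ i, μ[|W i] ≤ t • μ := by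
  refine ⟨1 + ∑ i, (μ (W i))⁻¹, by simp, by simpa [ENNReal.sum_eq_top] using hW, ?_⟩
  calc ∑ i, μ[|W i] ≤ ∑ i, (μ (W i))⁻¹ • μ := by
        unfold ProbabilityTheory.cond
        gcongr
        exact Measure.restrict_le_self
    _ = (∑ i, (μ (W i))⁻¹) • μ := (Finset.sum_smul ..).symm
    _ ≤ (1 + ∑ i, (μ (W i))⁻¹) • μ := by
        rw [add_smul]
        exact Measure.le_add_left le_rfl

lemma map_sum_map {Ω Y Z : Type*} [MeasurableSpace Ω] [MeasurableSpace Y] [MeasurableSpace Z]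
    {μ : Measure Ω} {g : Y → Z} {T : ι → Ω → Y} (hg : Measurable g) (hT : ∀ i, Measurable (T i)) :
    (∑ i, μ.map (T i)).map g = ∑ i, μ.map (g ∘ T i) := by
  simp only [Measure.map_finset_sum' hg.aemeasurable, Measure.map_map hg (hT _)]

lemma integral_sum_map {Ω Z : Type*} [MeasurableSpace Ω] [MeasurableSpace Z] {μ : Measure Ω}
    {T : ι → Ω → Z} {f : Z → ℝ} (hT : ∀ i, AEMeasurable (T i) μ)
    (hf : ∀ i, Integrable f (μ.map (T i))) :
    ∫ z, f z ∂(∑ i, μ.map (T i)) = ∫ ω, ∑ i, f (T i ω) ∂μ := by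
  have hint : ∀ i, Integrable (fun ω => f (T i ω)) μ := fun i =>
    (integrable_map_measure (hf i).aestronglyMeasurable (hT i)).1 (hf i)
  rw [integral_finsetSum_measure fun i _ => hf i, integral_finsetSum _ fun i _ => hint i]
  exact Finset.sum_congr rfl fun i _ => integral_map (hT i) (hf i).aestronglyMeasurable

lemma IsOptimalPlan.integral_sum_le {π : Measure (ι → X × Y)} [IsFiniteMeasure π]
    (h : IsOptimalPlan c (∑ i, π.map (Function.eval i))) (hc : Measurable c) {C : ℝ}
    (hC : ∀ p, ‖c p‖ ≤ C) (σ : Equiv.Perm ι) :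
    ∫ z, ∑ i, c (z i) ∂π ≤ ∫ z, ∑ i, c ((z (σ i)).1, (z i).2) ∂π := by
  have heval : ∀ i, Measurable (Function.eval i : (ι → X × Y) → X × Y) := measurable_pi_apply
  have hswap : ∀ i, Measurable fun z : ι → X × Y => ((z (σ i)).1, (z i).2) := by fun_prop
  have hint : ∀ (T : (ι → X × Y) → X × Y), Integrable c (π.map T) := fun T =>
    .of_bound hc.aestronglyMeasurable C (.of_forall hC)
  calc ∫ z, ∑ i, c (z i) ∂π = ∫ p, c p ∂(∑ i, π.map (Function.eval i)) :=
        (integral_sum_map (fun i => (heval i).aemeasurable) fun i => hint _).symm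
    _ ≤ ∫ p, c p ∂(∑ i, π.map fun z => ((z (σ i)).1, (z i).2)) := by
        refine h _ ?_ ?_
        · rw [Measure.fst, Measure.fst, map_sum_map measurable_fst hswap,
            map_sum_map measurable_fst heval]
          exact Equiv.sum_comp σ fun i => π.map (Prod.fst ∘ Function.eval i)
        · rw [Measure.snd, Measure.snd, map_sum_map measurable_snd hswap,
            map_sum_map measurable_snd heval]
          rfl
    _ = ∫ z, ∑ i, c ((z (σ i)).1, (z i).2) ∂π :=
        integral_sum_map (fun i => (hswap i).aemeasurable) fun i => hint _

lemma IsOptimalPlan.exists_sum_le_sum [IsFiniteMeasure γ] (h : IsOptimalPlan c γ)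
    (hc : Measurable c) {C : ℝ} (hC : ∀ p, ‖c p‖ ≤ C) {W : ι → Set (X × Y)}
    (hWm : ∀ i, MeasurableSet (W i)) (hW : ∀ i, γ (W i) ≠ 0) (σ : Equiv.Perm ι) :
    ∃ z : ι → X × Y, (∀ i, z i ∈ W i) ∧ ∑ i, c (z i) ≤ ∑ i, c ((z (σ i)).1, (z i).2) := by
  have hprob : ∀ i, IsProbabilityMeasure γ[|W i] := fun i => cond_isProbabilityMeasure (hW i)
  -- Independent pairs with the laws `γ[|W i]`: optimality compares their expected total costs.
  set π : Measure (ι → X × Y) := Measure.pi fun i => γ[|W i]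
  have heval : ∀ i, MeasurePreserving (Function.eval i) π γ[|W i] := measurePreserving_eval _
  have hopt : IsOptimalPlan c (∑ i, π.map (Function.eval i)) := by
    obtain ⟨t, ht₀, ht, hle⟩ := exists_sum_cond_le_smul hW
    have := Measure.smul_finite γ ht
    simp only [fun i => (heval i).map_eq]
    exact (h.smul ht₀ ht).of_le hc hC hle
  have hmem : ∀ᵐ z ∂π, ∀ i, z i ∈ W i := ae_all_iff.2 fun i =>
    (heval i).quasiMeasurePreserving.ae (ae_cond_mem (hWm i))
  have hint : ∀ T : ι → (ι → X × Y) → X × Y, (∀ i, Measurable (T i)) →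
      Integrable (fun z => ∑ i, c (T i z)) π := fun T hT => integrable_finsetSum _ fun i _ =>
    .of_bound (hc.comp (hT i)).aestronglyMeasurable C (.of_forall fun _ => hC _)
  have hint₁ := hint (fun i z => z i) (by fun_prop)
  have hint₂ := hint (fun i z => ((z (σ i)).1, (z i).2)) (by fun_prop)
  obtain ⟨z, hzW, hz⟩ := exists_notMem_null_le_integral (hint₁.sub hint₂) hmem
  simp only [Pi.sub_apply, integral_sub hint₁ hint₂] at hz
  exact ⟨z, not_not.1 hzW, by linarith [hopt.integral_sum_le hc hC σ]⟩

end OptimalPlans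

section CyclicallyMonotoneSupport

variable {X Y : Type*} [MeasurableSpace X] [TopologicalSpace X] [MeasurableSpace Y]
  [TopologicalSpace Y] {ι : Type*} {l : Filter ι}

lemma eventually_measure_pos_of_mem_support {Ω : Type*} [TopologicalSpace Ω] [MeasurableSpace Ω]
    [OpensMeasurableSpace Ω] [HasOuterApproxClosed Ω] {g : ι → ProbabilityMeasure Ω}
    {μ : ProbabilityMeasure Ω} (hg : Tendsto g l (𝓝 μ)) {x : Ω}
    (hx : x ∈ (μ : Measure Ω).support) {W : Set Ω} (hW : W ∈ 𝓝 x) :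
    ∀ᶠ k in l, 0 < (g k : Measure Ω) W := by
  obtain ⟨U, hUW, hU, hxU⟩ := mem_nhds_iff.1 hW
  have hpos : 0 < (μ : Measure Ω) U :=
    (Measure.mem_support_iff_forall x).1 hx U (hU.mem_nhds hxU)
  filter_upwards [eventually_lt_of_lt_liminf
    (hpos.trans_le (ProbabilityMeasure.le_liminf_measure_open_of_tendsto hg hU))] with k hk
  exact hk.trans_le (measure_mono hUW)

lemma isCyclicallyMonotone_support_of_tendsto [OpensMeasurableSpace (X × Y)]
    [HasOuterApproxClosed (X × Y)] [l.NeBot] {g : ι → ProbabilityMeasure (X × Y)}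
    {γ : ProbabilityMeasure (X × Y)} (hg : Tendsto g l (𝓝 γ)) {f : ι → X × Y → ℝ} {c : X × Y → ℝ}
    (hf : ∀ k, Measurable (f k)) {C : ι → ℝ} (hC : ∀ k p, ‖f k p‖ ≤ C k)
    (hfc : ∀ p, Tendsto (fun kp : ι × (X × Y) => f kp.1 kp.2) (l ×ˢ 𝓝 p) (𝓝 (c p)))
    (hopt : ∀ k, IsOptimalPlan (f k) (g k : Measure (X × Y))) :
    IsCyclicallyMonotone c (γ : Measure (X × Y)).support := by
  intro n q σ hq
  have hfreq : ∃ᶠ kz : ι × (Fin n → X × Y) in l ×ˢ 𝓝 q,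
      ∑ i, f kz.1 (kz.2 i) ≤ ∑ i, f kz.1 ((kz.2 (σ i)).1, (kz.2 i).2) := by
    intro hev
    obtain ⟨A, hA, B, hB, hAB⟩ := mem_prod_iff.1 hev
    rw [nhds_pi] at hB
    obtain ⟨I, -, W, hW, hWB⟩ := mem_pi.1 hB
    have hpos : ∀ᶠ k in l, ∀ i, 0 < (g k : Measure (X × Y)) (interior (W i)) :=
      eventually_all.2 fun i =>
        eventually_measure_pos_of_mem_support hg (hq i) (interior_mem_nhds.2 (hW i))
    obtain ⟨k, hk, hkA⟩ := (hpos.and hA).exists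
    obtain ⟨z, hzW, hz⟩ := (hopt k).exists_sum_le_sum (hf k) (hC k)
      (fun i => isOpen_interior.measurableSet) (fun i => (hk i).ne') σ
    exact hAB (Set.mk_mem_prod hkA (hWB fun i _ => interior_subset (hzW i))) hz
  have hlim : ∀ {T : (Fin n → X × Y) → X × Y}, Continuous T →
      Tendsto (fun kz : ι × (Fin n → X × Y) => f kz.1 (T kz.2)) (l ×ˢ 𝓝 q) (𝓝 (c (T q))) :=
    fun {T} hT => (hfc (T q)).comp (tendsto_fst.prodMk ((hT.tendsto q).comp tendsto_snd))
  exact le_of_tendsto_of_tendsto_of_frequently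
    (tendsto_finsetSum _ fun i _ => hlim (continuous_apply i))
    (tendsto_finsetSum _ fun i _ => hlim (T := fun z => ((z (σ i)).1, (z i).2)) (by fun_prop))
    hfreq

end CyclicallyMonotoneSupport

section Couplings

variable {X Y : Type*} [MeasurableSpace X] [MeasurableSpace Y]

/-- The couplings of two probability measures: the probability measures on the product with these
marginals. -/
def couplings (P : ProbabilityMeasure X) (Q : ProbabilityMeasure Y) :
    Set (ProbabilityMeasure (X × Y)) :=
  {γ | (γ : Measure (X × Y)).fst = P ∧ (γ : Measure (X × Y)).snd = Q}

lemma couplings_nonempty (P : ProbabilityMeasure X) (Q : ProbabilityMeasure Y) :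
    (couplings P Q).Nonempty :=
  ⟨P.prod Q, by simp [couplings]⟩

lemma isClosed_setOf_map_eq {Ω Ω' : Type*} [MeasurableSpace Ω] [TopologicalSpace Ω]
    [OpensMeasurableSpace Ω] [MeasurableSpace Ω'] [TopologicalSpace Ω'] [BorelSpace Ω']
    [HasOuterApproxClosed Ω'] {f : Ω → Ω'} (hf : Continuous f) (ν : ProbabilityMeasure Ω') :
    IsClosed {μ : ProbabilityMeasure Ω | (μ : Measure Ω).map f = ν} := by
  have h : IsClosed {μ : ProbabilityMeasure Ω | μ.map hf.measurable.aemeasurable = ν} :=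
    isClosed_singleton.preimage (ProbabilityMeasure.continuous_map hf)
  simpa only [← ProbabilityMeasure.toMeasure_injective.eq_iff, ProbabilityMeasure.toMeasure_map]
    using h

variable [TopologicalSpace X] [PolishSpace X] [BorelSpace X] [TopologicalSpace Y] [PolishSpace Y]
  [BorelSpace Y]

lemma isCompact_couplings (P : ProbabilityMeasure X) (Q : ProbabilityMeasure Y) :
    IsCompact (couplings P Q) := by
  let _ := TopologicalSpace.upgradeIsCompletelyMetrizable X
  let _ := TopologicalSpace.upgradeIsCompletelyMetrizable Y
  have htight : IsTightMeasureSet {(γ : Measure (X × Y)) | γ ∈ couplings P Q} := by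
    refine .prodMk ((isTightMeasureSet_singleton (μ := (P : Measure X))).subset ?_)
      ((isTightMeasureSet_singleton (μ := (Q : Measure Y))).subset ?_)
    · rintro _ ⟨_, ⟨γ, hγ, rfl⟩, rfl⟩
      exact hγ.1
    · rintro _ ⟨_, ⟨γ, hγ, rfl⟩, rfl⟩
      exact hγ.2
  have hclosed : IsClosed (couplings P Q) :=
    (isClosed_setOf_map_eq continuous_fst P).inter (isClosed_setOf_map_eq continuous_snd Q)
  simpa only [hclosed.closure_eq] using isCompact_closure_of_isTightMeasureSet htight

lemma exists_isOptimalPlan (P : ProbabilityMeasure X) (Q : ProbabilityMeasure Y)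
    (c : BoundedContinuousFunction (X × Y) ℝ) :
    ∃ γ ∈ couplings P Q, IsOptimalPlan c (γ : Measure (X × Y)) := by
  obtain ⟨γ, hγ, hmin⟩ := (isCompact_couplings P Q).exists_isMinOn (couplings_nonempty P Q)
    (ProbabilityMeasure.continuous_integral_boundedContinuousFunction c).continuousOn
  refine ⟨γ, hγ, fun γ' hfst hsnd => ?_⟩
  have hprob : IsProbabilityMeasure γ' :=
    ⟨by rw [← Measure.fst_univ, hfst, Measure.fst_univ, measure_univ]⟩
  exact hmin (show ⟨γ', hprob⟩ ∈ couplings P Q from ⟨hfst.trans hγ.1, hsnd.trans hγ.2⟩)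

lemma exists_boundedContinuousFunction_eq_of_abs_le {Z : Type*} [TopologicalSpace Z] {c : Z → ℝ}
    (hc : Continuous c) (k : ℕ) :
    ∃ f : BoundedContinuousFunction Z ℝ, ∀ z, |c z| ≤ k → f z = c z := by
  refine ⟨.ofNormedAddCommGroup (fun z => max (-k) (min k (c z))) (by fun_prop) k fun z => ?_,
    fun z hz => ?_⟩
  · exact abs_le.2 ⟨le_max_left _ _, max_le (neg_le_self k.cast_nonneg) (min_le_left _ _)⟩
  · obtain ⟨hl, hu⟩ := abs_le.1 hz
    simp [hl, hu]

theorem exists_coupling_isCyclicallyMonotone_support (P : ProbabilityMeasure X)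
    (Q : ProbabilityMeasure Y) {c : X × Y → ℝ} (hc : Continuous c) :
    ∃ γ ∈ couplings P Q, IsCyclicallyMonotone c (γ : Measure (X × Y)).support := by
  choose f hf using exists_boundedContinuousFunction_eq_of_abs_le hc
  choose g hg hopt using fun k => exists_isOptimalPlan P Q (f k)
  obtain ⟨γ, hγ, hclu⟩ := (isCompact_couplings P Q).exists_mapClusterPt
    (f := atTop) (u := g) (tendsto_principal.2 (.of_forall hg))
  obtain ⟨U, hU, hlim⟩ := mapClusterPt_iff_ultrafilter.1 hclu
  refine ⟨γ, hγ, isCyclicallyMonotone_support_of_tendsto hlim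
    (fun k => (f k).continuous.measurable) (fun k => (f k).norm_coe_le_norm) (fun p => ?_) hopt⟩
  have hbound : ∀ᶠ kp : ℕ × (X × Y) in (U : Filter ℕ) ×ˢ 𝓝 p, |c kp.2| ≤ kp.1 := by
    have hnear : ∀ᶠ p' in 𝓝 p, |c p'| < |c p| + 1 :=
      hc.abs.tendsto p (Iio_mem_nhds (lt_add_one _))
    have hlarge : ∀ᶠ k : ℕ in U, |c p| + 1 ≤ k :=
      (tendsto_natCast_atTop_atTop.mono_left hU).eventually_ge_atTop _
    filter_upwards [hlarge.prod_mk hnear] with kp hkp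
    exact hkp.2.le.trans hkp.1
  refine ((hc.tendsto p).comp tendsto_snd).congr' ?_
  filter_upwards [hbound] with kp hkp
  exact (hf _ _ hkp).symm

end Couplings

section TransportMap

variable {X Y : Type*} [MeasurableSpace X] [MeasurableSpace Y] {γ : Measure (X × Y)}

lemma ae_fst_ae_condKernel [IsFiniteMeasure γ] [StandardBorelSpace Y] [Nonempty Y]
    {p : X × Y → Prop} (h : ∀ᵐ z ∂γ, p z) :
    ∀ᵐ x ∂γ.fst, ∀ᵐ y ∂γ.condKernel x, p (x, y) := by
  rw [← γ.disintegrate γ.condKernel] at h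
  exact Measure.ae_ae_of_ae_compProd h

lemma aemeasurable_of_ae_snd_eq [IsFiniteMeasure γ] [StandardBorelSpace Y] {f : X → Y}
    (h : ∀ᵐ p ∂γ, p.2 = f p.1) : AEMeasurable f γ.fst := by
  rcases isEmpty_or_nonempty Y
  · exact (measurable_of_subsingleton_codomain f).aemeasurable
  refine NullMeasurable.aemeasurable fun B hB => ?_
  have hm : MeasurableSet {x | γ.condKernel x B = 1} :=
    measurableSet_eq_fun (γ.condKernel.measurable_coe hB) measurable_const
  refine hm.nullMeasurableSet.congr ?_
  filter_upwards [ae_fst_ae_condKernel h] with x hx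
  exact propext <| (mem_ae_iff_prob_eq_one hB).symm.trans <|
    (eventually_congr (hx.mono fun y hy => Iff.of_eq (congrArg (· ∈ B) hy))).trans
      eventually_const

lemma map_fst_eq_snd_of_ae_snd_eq {f : X → Y} (hf : AEMeasurable f γ.fst)
    (h : ∀ᵐ p ∂γ, p.2 = f p.1) : γ.fst.map f = γ.snd := by
  rw [Measure.fst, AEMeasurable.map_map_of_aemeasurable hf measurable_fst.aemeasurable]
  exact (Measure.map_congr h).symm

end TransportMap

section Existence

variable {H : Type*} [NormedAddCommGroup H] [InnerProductSpace ℝ H] [CompleteSpace H]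
  [TopologicalSpace.SeparableSpace H] [MeasurableSpace H] [BorelSpace H]

lemma gradPushesForward_of_ae_mem_subdifferential {ψ : H → EReal} {γ : Measure (H × H)}
    [IsFiniteMeasure γ] (hγ : ∀ᵐ p ∂γ, p.2 ∈ subdifferential ψ p.1)
    (hs : ∀ᵐ x ∂γ.fst, (subdifferential ψ x).Subsingleton) :
    GradPushesForward ψ γ.fst γ.snd := by
  have hdom : ∀ᵐ p ∂γ, p.1 ∈ gradDomain ψ := by
    filter_upwards [hγ, ae_of_ae_map measurable_fst.aemeasurable hs] with p hp hsp
    exact mem_gradDomain_of_subsingleton hsp hp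
  have hgrad : ∀ᵐ p ∂γ, p.2 = grad ψ p.1 := by
    filter_upwards [hγ, hdom] with p hp hpd using eq_grad_of_mem_subdifferential hpd hp
  have hmeas : AEMeasurable (grad ψ) γ.fst := aemeasurable_of_ae_snd_eq hgrad
  refine ⟨?_, hmeas, map_fst_eq_snd_of_ae_snd_eq hmeas hgrad⟩
  filter_upwards [ae_fst_ae_condKernel hdom] with x hx
  exact Filter.eventually_const.1 hx

theorem exists_gradPushesForward (P Q : Measure H) [IsProbabilityMeasure P]
    [IsProbabilityMeasure Q] (hP : NullOnLipschitzHypersurfaces P) :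
    ∃ ψ : H → EReal, IsProperConvex ψ ∧ LowerSemicontinuous ψ ∧ GradPushesForward ψ P Q := by
  obtain ⟨γ, ⟨hfst, hsnd⟩, hS⟩ := exists_coupling_isCyclicallyMonotone_support ⟨P, ‹_›⟩ ⟨Q, ‹_›⟩
    (c := fun p : H × H => -inner ℝ p.2 p.1) (by fun_prop)
  obtain rfl : (γ : Measure (H × H)).fst = P := hfst
  obtain rfl : (γ : Measure (H × H)).snd = Q := hsnd
  obtain ⟨p₀, hp₀⟩ := Measure.nonempty_support (IsProbabilityMeasure.ne_zero (γ : Measure (H × H)))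
  have hψ := hS.isProperConvex_rockafellar hp₀
  have hmono := isMonotoneOperator_subdifferential hψ.ne_bot hψ.exists_ne_top
  refine ⟨_, hψ, lowerSemicontinuous_rockafellar _ _,
    gradPushesForward_of_ae_mem_subdifferential ?_ (hP.ae_subsingleton hmono)⟩
  filter_upwards [Measure.support_mem_ae (μ := (γ : Measure (H × H)))] with p hp
  exact mem_subdifferential_rockafellar p₀ hp

end Existence

end HilbertTransport

theorem theorem1_general {H : Type*} [NormedAddCommGroup H] [InnerProductSpace ℝ H]
    [CompleteSpace H] [TopologicalSpace.SeparableSpace H] [MeasurableSpace H] [BorelSpace H]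
    (P Q : Measure H) [IsProbabilityMeasure P] [IsProbabilityMeasure Q] :
    (HilbertTransport.NullOnLipschitzHypersurfaces P →
      ∃ ψ : H → EReal, HilbertTransport.IsProperConvex ψ ∧ LowerSemicontinuous ψ ∧
        HilbertTransport.GradPushesForward ψ P Q) ∧
    ∀ ψ₁ ψ₂ : H → EReal,
      HilbertTransport.GradPushesForward ψ₁ P Q → HilbertTransport.GradPushesForward ψ₂ P Q →
      ∀ᵐ x ∂P, HilbertTransport.grad ψ₁ x = HilbertTransport.grad ψ₂ x :=
  ⟨HilbertTransport.exists_gradPushesForward P Q, fun _ _ h₁ h₂ => h₁.ae_eq h₂⟩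

theorem theorem1 {H : Type*} [NormedAddCommGroup H] [InnerProductSpace ℝ H] [CompleteSpace H]
    [TopologicalSpace.SeparableSpace H] [MeasurableSpace H] [BorelSpace H]
    (P Q : Measure H) [IsProbabilityMeasure P] [IsProbabilityMeasure Q]
    (hP : HilbertTransport.NullOnLipschitzHypersurfaces P) :
    (∃ ψ : H → EReal, HilbertTransport.IsProperConvex ψ ∧ LowerSemicontinuous ψ ∧
      HilbertTransport.GradPushesForward ψ P Q) ∧
    (Bornology.IsBounded Q.support →
      ∀ ψ₁ ψ₂ : H → EReal,
        HilbertTransport.IsProperConvex ψ₁ → HilbertTransport.GradPushesForward ψ₁ P Q →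
        HilbertTransport.IsProperConvex ψ₂ → HilbertTransport.GradPushesForward ψ₂ P Q →
        ∀ᵐ x ∂P, HilbertTransport.grad ψ₁ x = HilbertTransport.grad ψ₂ x) :=
  have ⟨hex, huniq⟩ := theorem1_general P Q
  ⟨hex hP, fun _ ψ₁ ψ₂ _ h₁ _ h₂ => huniq ψ₁ ψ₂ h₁ h₂⟩
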